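/- Let $\mathbb M$ be a connected smooth $d$-dimensional Riemannian manifold with Riemannian distance $\mathrm{dist}$ and exponential maps $\mathrm{Exp}_z$; $B(x,r)$ denotes the open ball, $\overline{B(x,r)}$ the closed ball $\{y:\mathrm{dist}(x,y)\le r\}$, and $\|f\|_{C(S)}=\sup_{x\in S}|f(x)|$ (with $|\nabla f(x)|$ the dual norm of the covector $\nabla f(x)$). *Function space.* Let $\Pi\subset C^1(\mathbb M)$ be a finite-dimensional space of real functions and $\mathfrak D,\mathfrak M,r^\sharp>0$ constants such that for all $p\in\Pi$, $0<r<r^\sharp$, $x_0\in\mathbb M$, $$\|p\|_{C(B(x_0,2r))}\le 2^{\mathfrak D}\|p\|_{C(B(x_0,r))},\qquad \|\nabla p\|_{C(B(x_0,r))}\le \frac{\mathfrak M}{r}\|p\|_{C(B(x_0,r))}.$$ *Domain.* Let $\Omega\subset\mathbb M$ be compact. Let $r_\Omega>0$ be such that for every $z\in\Omega$ the map $\mathrm{Exp}_z$ is defined on the ball $B(0,r_\Omega)\subset T_z\mathbb M$ and is a smooth diffeomorphism of it onto an open set, and let $\Gamma_1>0$ satisfy $\Gamma_1\|v-w\|\le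 \mathrm{dist}(\mathrm{Exp}_z v,\mathrm{Exp}_z w)$ for all $z\in\Omega$ and $v,w\in B(0,r_\Omega)$. Assume that $\Omega$ satisfies the interior geodesic cone condition with radius $r^\flat>0$ and aperture $\omega\in(0,\pi/2)$: for each $z\in\Omega$ there is a unit vector $v\in T_z\mathbb M$ such that $\mathrm{Exp}_z$ is defined on the cone $C=\{w\in T_z\mathbb M:\|w\|\le r^\flat,\ \langle v,w\rangle\ge\|w\|\cos\omega\}$ and $\mathrm{Exp}_z(C)\subset\Omega$. *Constants.* Put $r^*=\min(r_\Omega,r^\sharp,r^\flat)$ and $$\kappa=\mathfrak M\,2^{2\mathfrak D}\Bigl(\frac{2+\sin\omega}{\Gamma_1\sin\omega}\Bigr)^{\mathfrak D}\,\frac{1+\Gamma_1\sin\omega}{\Gamma_1\sin\omega},$$ and assume that $\kappa>\frac{1+\Gamma_1\sin\omega}{\Gamma_1\sin\omega}$, i.e. $\mathfrak M 2^{2\mathfrak D}\bigl(\frac{2+\sin\omega}{\Gamma_1\sin\omega}\bigr)^{\mathfrak D}>1$ (automatic if $\mathfrak M\ge1$ and $\Omega\neq\emptyset$, hence always achievable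 by enlarging $\mathfrak M$). Let $\epsilon>0$, $0<R\le \frac{r^*}{1+\epsilon}$, and let $\Xi\subset\Omega$ have fill distance $h_{\Xi,\Omega}=\sup_{x\in\Omega}\mathrm{dist}(x,\Xi)\le \epsilon\frac{R}{\kappa}$ (the distance to the empty set being $\infty$). Then for every $x\in\Omega$ and $p\in\Pi$ there is a point $\xi\in\Xi\cap B(x,(1+\epsilon)R)$ with $$|p(\xi)|\ \ge\ (1-\epsilon)\,\|p\|_{C(\overline{B(x,R)}\cap\Omega)};$$ in particular, for finite $\Xi$, $$\max_{\xi\in\Xi\cap B(x,(1+\epsilon)R)}|p(\xi)|\ \ge\ (1-\epsilon)\,\|p\|_{C(\overline{B(x,R)}\cap\Omega)}.$$ Consequently, if $\epsilon<1$, then for every $x\in\Omega$ the set $\Xi\cap B(x,(1+\epsilon)R)$ is a norming set for $(\Pi,\|\cdot\|_{C(\overline{B(x,R)}\cap\Omega)})$: there is $c>0$ with $\sup_{\xi\in\Xi\cap B(x,(1+\epsilon)R)}|p(\xi)|\ge c\,\|p\|_{C(\overline{B(x,R)}\cap\Omega)}$ for all $p\in\Pi$. -/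

import Mathlib

open Set Metric Manifold Bundle
open scoped ENNReal ContDiff

namespace NormingSets

noncomputable section

section Geometry

variable {d : ℕ} {M : Type*} [MetricSpace M] [ChartedSpace (EuclideanSpace ℝ (Fin d)) M]
  [RiemannianBundle (fun x : M => TangentSpace (𝓡 d) x)]

/-- The Riemannian metric written in the chart at `c`: for a point `u` of the chart's image and
coordinate vectors `v`, `w`, this is `∑ g_ij(u) v_i w_j`, the inner product of the tangent vectors
with coordinates `v` and `w`. -/
def metricInChart (c : M) (u v w : EuclideanSpace ℝ (Fin d)) : ℝ :=
  inner ℝ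
    (mfderiv 𝓘(ℝ, EuclideanSpace ℝ (Fin d)) (𝓡 d) (extChartAt (𝓡 d) c).symm u v :
      TangentSpace (𝓡 d) ((extChartAt (𝓡 d) c).symm u))
    (mfderiv 𝓘(ℝ, EuclideanSpace ℝ (Fin d)) (𝓡 d) (extChartAt (𝓡 d) c).symm u w :
      TangentSpace (𝓡 d) ((extChartAt (𝓡 d) c).symm u))

/-- The Christoffel symbols of the first kind in the chart at `c`, as a trilinear expression:
`∑ ½ (∂_i g_jk + ∂_j g_ik - ∂_k g_ij)(u) a_i b_j w_k`. -/
def christoffelFirst (c : M) (u a b w : EuclideanSpace ℝ (Fin d)) : ℝ :=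
  (1 / 2) * (fderiv ℝ (fun y => metricInChart c y b w) u a
    + fderiv ℝ (fun y => metricInChart c y a w) u b
    - fderiv ℝ (fun y => metricInChart c y a b) u w)

/-- `γ` is a geodesic on the open set of times `J`: it is smooth there, and in every chart of the
atlas its coordinate curve `u` satisfies the geodesic equation
`u''_k + ∑ Γ^k_ij(u) u'_i u'_j = 0`, here with the index `k` lowered by the metric, that is
`g_u(u'', w) + ∑ Γ_ijk(u) u'_i u'_j w_k = 0` for all coordinate vectors `w`. -/
def IsGeodesicOn (γ : ℝ → M) (J : Set ℝ) : Prop :=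
  ContMDiffOn 𝓘(ℝ, ℝ) (𝓡 d) ∞ γ J ∧
  ∀ t ∈ J, ∀ c : M, γ t ∈ (chartAt (EuclideanSpace ℝ (Fin d)) c).source →
    ∀ w : EuclideanSpace ℝ (Fin d),
      metricInChart c (extChartAt (𝓡 d) c (γ t))
          (deriv (deriv (fun s => extChartAt (𝓡 d) c (γ s))) t) w
        + christoffelFirst c (extChartAt (𝓡 d) c (γ t))
          (deriv (fun s => extChartAt (𝓡 d) c (γ s)) t)
          (deriv (fun s => extChartAt (𝓡 d) c (γ s)) t) w = 0

/-- `y = Exp_z(v)`: there is a geodesic `γ`, defined on an open interval that contains `[0, 1]`,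
with `γ(0) = z`, `γ'(0) = v` and `γ(1) = y`. -/
def IsExp (z : M) (v : TangentSpace (𝓡 d) z) (y : M) : Prop :=
  ∃ (γ : ℝ → M) (δ : ℝ), 0 < δ ∧ IsGeodesicOn (d := d) γ (Ioo (-δ) (1 + δ)) ∧
    (⟨γ 0, mfderiv 𝓘(ℝ, ℝ) (𝓡 d) γ 0 (1 : ℝ)⟩ : TangentBundle (𝓡 d) M) = ⟨z, v⟩ ∧
    γ 1 = y

/-- The domain of the exponential map at `z`: those `v` whose geodesic exists up to time `1`. -/
def expDomain (z : M) : Set (TangentSpace (𝓡 d) z) :=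
  {v | ∃ y, IsExp z v y}

open Classical in
/-- The Riemannian exponential map at `z` (with the value `z` outside of its domain). -/
def Exp (z : M) (v : TangentSpace (𝓡 d) z) : M :=
  if h : ∃ y, IsExp z v y then h.choose else z

/-- The cone with vertex `0`, radius `r`, aperture `θ` and axis `v` in a tangent space. -/
def tangentCone (z : M) (r θ : ℝ) (v : TangentSpace (𝓡 d) z) : Set (TangentSpace (𝓡 d) z) :=
  {w | ‖w‖ ≤ r ∧ ‖w‖ * Real.cos θ ≤ inner ℝ v w}

variable (d) in
/-- The interior geodesic cone condition with radius `r` and aperture `θ`: at each point `z` of `Ω`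
there is a unit direction `v` such that `Exp_z` is defined on the cone of radius `r`, aperture `θ`
and axis `v`, and maps it into `Ω`. -/
def GeodesicConeCondition (Ω : Set M) (r θ : ℝ) : Prop :=
  ∀ z ∈ Ω, ∃ v : TangentSpace (𝓡 d) z, ‖v‖ = 1 ∧
    ∀ w ∈ tangentCone z r θ v, w ∈ expDomain z ∧ Exp z w ∈ Ω

variable (d) in
/-- `r` is a radius on which all exponential maps with centre in `Ω` are smooth diffeomorphisms
onto their (open) images and are bounded below with the constant `Γ₁`:
`Γ₁ ‖v - w‖ ≤ dist (Exp_z v) (Exp_z w)`. -/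
structure IsExpRadius (Ω : Set M) (r Γ₁ : ℝ) : Prop where
  radius_pos : 0 < r
  const_pos : 0 < Γ₁
  defined : ∀ z ∈ Ω, ball (0 : TangentSpace (𝓡 d) z) r ⊆ expDomain z
  injective : ∀ z ∈ Ω, InjOn (Exp z) (ball (0 : TangentSpace (𝓡 d) z) r)
  localDiffeo : ∀ z ∈ Ω, IsLocalDiffeomorphOn 𝓘(ℝ, TangentSpace (𝓡 d) z) (𝓡 d) ∞
    (Exp z) (ball (0 : TangentSpace (𝓡 d) z) r)
  lower : ∀ z ∈ Ω, ∀ v ∈ ball (0 : TangentSpace (𝓡 d) z) r,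
    ∀ w ∈ ball (0 : TangentSpace (𝓡 d) z) r, Γ₁ * ‖v - w‖ ≤ dist (Exp z v) (Exp z w)

/-- `‖p‖_{C(S)}`, the supremum of `|p|` over `S`, as an element of `[0, ∞]`. -/
def supNorm (p : M → ℝ) (S : Set M) : ℝ≥0∞ :=
  ⨆ x ∈ S, ‖p x‖ₑ

variable (d) in
/-- The covector `∇p(x)`. -/
def grad (p : M → ℝ) (x : M) : TangentSpace (𝓡 d) x →L[ℝ] ℝ :=
  mfderiv (𝓡 d) 𝓘(ℝ, ℝ) p x

variable (d) in
/-- `‖∇p‖_{C(S)}`: the supremum over `S` of the dual norm of `∇p` for the Riemannian metric. -/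
def supNormGrad (p : M → ℝ) (S : Set M) : ℝ≥0∞ :=
  ⨆ x ∈ S, ‖grad d p x‖ₑ

variable (d) in
/-- `P` is a finite-dimensional space of `C¹` functions that satisfies the doubling condition with
exponent `D` and the Markov inequality with constant `K` on all balls of radius less than `r₀`. -/
structure DoublingMarkov (P : Submodule ℝ (M → ℝ)) (D K r₀ : ℝ) : Prop where
  finiteDimensional : FiniteDimensional ℝ P
  contMDiff : ∀ p ∈ P, ContMDiff (𝓡 d) 𝓘(ℝ, ℝ) 1 p
  exponent_pos : 0 < D
  const_pos : 0 < K
  radius_pos : 0 < r₀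
  doubling : ∀ p ∈ P, ∀ r : ℝ, 0 < r → r < r₀ → ∀ x₀ : M,
    supNorm p (ball x₀ (2 * r)) ≤ ENNReal.ofReal ((2 : ℝ) ^ D) * supNorm p (ball x₀ r)
  markov : ∀ p ∈ P, ∀ r : ℝ, 0 < r → r < r₀ → ∀ x₀ : M,
    supNormGrad d p (ball x₀ r) ≤ ENNReal.ofReal (K / r) * supNorm p (ball x₀ r)

/-- The fill distance `sup_{x ∈ Ω} dist(x, Ξ)` (with the distance to the empty set infinite). -/
def fillDistance (Ξ Ω : Set M) : ℝ≥0∞ :=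
  ⨆ x ∈ Ω, infEDist x Ξ

/-- The sampling operator `p ↦ p|_S` is bounded below as a map from `P`, with the (semi)norm of
`C(A)`, to `ℓ_∞(S)`. -/
def IsNormingSet (P : Submodule ℝ (M → ℝ)) (A S : Set M) : Prop :=
  ∃ c : ℝ, 0 < c ∧ ∀ p ∈ P, ENNReal.ofReal c * supNorm p A ≤ supNorm p S

end Geometry

/-- `κ = K 2^{2D} ((2 + sin θ) / (Γ₁ sin θ))^D (1 + Γ₁ sin θ) / (Γ₁ sin θ)`. -/
def kappa (K D Γ₁ θ : ℝ) : ℝ :=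
  K * (2 : ℝ) ^ (2 * D) * ((2 + Real.sin θ) / (Γ₁ * Real.sin θ)) ^ D *
    ((1 + Γ₁ * Real.sin θ) / (Γ₁ * Real.sin θ))

end

end NormingSets

open NormingSets

open Filter Topology MeasureTheory

/-! Let `z` maximize `|p|` on the compact set `closedBall x R ∩ Ω`. At a sample point `ξ` near `z`,
`p` differs from `p z` by at most a distance bound times the supremum of `|∇p|` near `z`. By the
Markov inequality and repeated doubling, that supremum is controlled by the supremum of `|p|` on any
smaller ball `ball y ρ` near `z`, at a cost depending on `R / ρ`. The cone condition provides such a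
ball inside `closedBall x R ∩ Ω` (`exists_ball_subset`), where `|p| ≤ |p z|`. The constant `κ` is
chosen so that the total change is at most `ε |p z|`.

The ball comes from two facts on exponential maps. Geodesics have constant speed, hence `dist z (Exp
z v) ≤ ‖v‖` (`dist_Exp_le`). The lower bound `Γ₁`, with local invertibility, makes the image of a
ball contain a ball of radius scaled by `Γ₁` (`IsExpRadius.ball_subset_image`). The first fact keeps
image points within `R` of `x`, the second fills a metric ball with images of cone vectors. -/

/-! ### The metric in coordinates and the constant speed of geodesics. -/

theorem hasDerivAt_comp_fderiv {E W : Type*} [NormedAddCommGroup E] [NormedSpace ℝ E]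
    [NormedAddCommGroup W] [NormedSpace ℝ W] {G : E → W} {u : ℝ → E} {t : ℝ}
    (hG : DifferentiableAt ℝ G (u t)) (hu : DifferentiableAt ℝ u t) :
    HasDerivAt (fun s => G (u s)) (fderiv ℝ G (u t) (deriv u t)) t :=
  hG.hasFDerivAt.comp_hasDerivAt t hu.hasDerivAt

set_option synthInstance.maxHeartbeats 200000 in
theorem hasDerivAt_bilinear_self {E : Type*} [NormedAddCommGroup E] [NormedSpace ℝ E]
    {G : E → E →L[ℝ] E →L[ℝ] ℝ} {u a : ℝ → E} {t : ℝ} (hG : DifferentiableAt ℝ G (u t))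
    (hu : DifferentiableAt ℝ u t) (ha : DifferentiableAt ℝ a t) :
    HasDerivAt (fun s => G (u s) (a s) (a s))
      (fderiv ℝ G (u t) (deriv u t) (a t) (a t) + G (u t) (deriv a t) (a t) +
        G (u t) (a t) (deriv a t)) t := by
  have h1 := hasDerivAt_comp_fderiv (W := E →L[ℝ] E →L[ℝ] ℝ) hG hu
  exact (h1.clm_apply ha.hasDerivAt).clm_apply ha.hasDerivAt

set_option synthInstance.maxHeartbeats 200000 in
theorem fderiv_bilinear_apply {E : Type*} [NormedAddCommGroup E] [NormedSpace ℝ E]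
    {G : E → E →L[ℝ] E →L[ℝ] ℝ} {x : E} (hG : DifferentiableAt ℝ G x) (a b w : E) :
    fderiv ℝ (fun y => G y b w) x a = fderiv ℝ G x a b w := by
  rw [((hG.hasFDerivAt.clm_apply (hasFDerivAt_const b x)).clm_apply
    (hasFDerivAt_const w x)).fderiv]
  simp

section

variable {d : ℕ} {M : Type*} [MetricSpace M] [ChartedSpace (EuclideanSpace ℝ (Fin d)) M]
  [RiemannianBundle (fun x : M => TangentSpace (𝓡 d) x)]

namespace NormingSets

theorem metricInChart_add_left (c : M) (u a b w : EuclideanSpace ℝ (Fin d)) :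
    metricInChart c u (a + b) w = metricInChart c u a w + metricInChart c u b w := by
  have h := (mfderiv 𝓘(ℝ, EuclideanSpace ℝ (Fin d)) (𝓡 d) (extChartAt (𝓡 d) c).symm u).map_add a b
  exact (congrArg (fun z : TangentSpace (𝓡 d) ((extChartAt (𝓡 d) c).symm u) =>
    (inner ℝ z (mfderiv 𝓘(ℝ, EuclideanSpace ℝ (Fin d)) (𝓡 d) (extChartAt (𝓡 d) c).symm u w :
      TangentSpace (𝓡 d) ((extChartAt (𝓡 d) c).symm u)) : ℝ)) h).trans (inner_add_left _ _ _)

theorem metricInChart_smul_left (c : M) (u : EuclideanSpace ℝ (Fin d)) (r : ℝ)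
    (a w : EuclideanSpace ℝ (Fin d)) :
    metricInChart c u (r • a) w = r * metricInChart c u a w := by
  have h := (mfderiv 𝓘(ℝ, EuclideanSpace ℝ (Fin d)) (𝓡 d) (extChartAt (𝓡 d) c).symm u).map_smul r a
  exact (congrArg (fun z : TangentSpace (𝓡 d) ((extChartAt (𝓡 d) c).symm u) =>
    (inner ℝ z (mfderiv 𝓘(ℝ, EuclideanSpace ℝ (Fin d)) (𝓡 d) (extChartAt (𝓡 d) c).symm u w :
      TangentSpace (𝓡 d) ((extChartAt (𝓡 d) c).symm u)) : ℝ)) h).trans (real_inner_smul_left _ _ _)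

theorem metricInChart_comm (c : M) (u v w : EuclideanSpace ℝ (Fin d)) :
    metricInChart c u v w = metricInChart c u w v := real_inner_comm _ _

/-- The metric in the chart at `c` as a continuous bilinear form depending on the point. -/
noncomputable def metricForm (c : M) (u : EuclideanSpace ℝ (Fin d)) :
    EuclideanSpace ℝ (Fin d) →L[ℝ] EuclideanSpace ℝ (Fin d) →L[ℝ] ℝ :=
  LinearMap.toContinuousLinearMap
    ((LinearMap.toContinuousLinearMap :
        (EuclideanSpace ℝ (Fin d) →ₗ[ℝ] ℝ) ≃ₗ[ℝ] _).toLinearMap ∘ₗ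
      LinearMap.mk₂ ℝ (metricInChart c u)
        (metricInChart_add_left c u) (metricInChart_smul_left c u)
        (fun a b w => by simp only [metricInChart_comm c u a, metricInChart_add_left])
        (fun r a w => by simp only [metricInChart_comm c u a, metricInChart_smul_left, smul_eq_mul]))

@[simp]
theorem metricForm_apply (c : M) (u v w : EuclideanSpace ℝ (Fin d)) :
    metricForm c u v w = metricInChart c u v w := rfl

theorem isExp_Exp {z : M} {v : TangentSpace (𝓡 d) z} (h : v ∈ expDomain z) : IsExp z v (Exp z v) := by
  have h' : ∃ y, IsExp z v y := h
  rw [Exp, dif_pos h']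
  exact h'.choose_spec

/-- Two points at distance less than `r` are joined by a `C¹` path of length less than `r` that
stays in the ball of radius `r` around the first one. -/
theorem exists_path_of_dist_lt [IsRiemannianManifold (𝓡 d) M] {x y : M} {r : ℝ} (h : dist x y < r) :
    ∃ γ : ℝ → M, γ 0 = x ∧ γ 1 = y ∧ ContMDiffOn 𝓘(ℝ, ℝ) (𝓡 d) 1 γ (Icc 0 1) ∧
      Manifold.pathELength (𝓡 d) γ 0 1 < ENNReal.ofReal r ∧ ∀ t ∈ Icc (0 : ℝ) 1, γ t ∈ ball x r := by
  have h' : Manifold.riemannianEDist (𝓡 d) x y < ENNReal.ofReal r := by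
    rwa [← IsRiemannianManifold.out (I := 𝓡 d) x y, edist_lt_ofReal]
  obtain ⟨γ, h0, h1, hγ, hl⟩ := Manifold.exists_lt_of_riemannianEDist_lt h'
  refine ⟨γ, h0, h1, hγ, hl, fun t ht => ?_⟩
  rw [mem_ball', ← edist_lt_ofReal, IsRiemannianManifold.out (I := 𝓡 d) x (γ t)]
  calc Manifold.riemannianEDist (𝓡 d) x (γ t) ≤ Manifold.pathELength (𝓡 d) γ 0 t :=
        Manifold.riemannianEDist_le_pathELength (hγ.mono (Icc_subset_Icc_right ht.2)) h0 rfl ht.1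
    _ ≤ Manifold.pathELength (𝓡 d) γ 0 1 := Manifold.pathELength_mono le_rfl ht.2
    _ < _ := hl

variable [IsManifold (𝓡 d) ∞ M]
  [IsContMDiffRiemannianBundle (𝓡 d) ∞ (EuclideanSpace ℝ (Fin d))
      (fun x : M => TangentSpace (𝓡 d) x)]

theorem contDiffOn_metricInChart (c : M) (v w : EuclideanSpace ℝ (Fin d)) :
    ContDiffOn ℝ 1 (fun y => metricInChart c y v w) (extChartAt (𝓡 d) c).target := by
  have hopen : IsOpen (extChartAt (𝓡 d) c).target := isOpen_extChartAt_target c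
  have key : ∀ v : EuclideanSpace ℝ (Fin d),
      ContMDiffOn 𝓘(ℝ, EuclideanSpace ℝ (Fin d)) (𝓡 d).tangent 1
      (fun y => (⟨(extChartAt (𝓡 d) c).symm y,
        mfderiv 𝓘(ℝ, EuclideanSpace ℝ (Fin d)) (𝓡 d) (extChartAt (𝓡 d) c).symm y v⟩ :
          TangentBundle (𝓡 d) M)) (extChartAt (𝓡 d) c).target := by
    intro v
    have h1 := (contMDiffOn_extChartAt_symm (I := 𝓡 d) (n := ∞) c).contMDiffOn_tangentMapWithin
      (m := 1) (by norm_cast) hopen.uniqueMDiffOn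
    have h2 : ContMDiff 𝓘(ℝ, EuclideanSpace ℝ (Fin d))
        (𝓘(ℝ, EuclideanSpace ℝ (Fin d))).tangent 1
        (fun y => (⟨y, v⟩ : TangentBundle 𝓘(ℝ, EuclideanSpace ℝ (Fin d))
          (EuclideanSpace ℝ (Fin d)))) := by
      intro y
      exact contMDiffAt_vectorSpace_iff_contDiffAt.2 contDiffAt_const
    refine (h1.comp h2.contMDiffOn (s := (extChartAt (𝓡 d) c).target) (fun y hy => hy)).congr ?_
    intro y hy
    simp only [Function.comp, tangentMapWithin]
    rw [mfderivWithin_of_isOpen hopen hy]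
  have : IsContMDiffRiemannianBundle (𝓡 d) 1 (EuclideanSpace ℝ (Fin d))
      (fun x : M => TangentSpace (𝓡 d) x) := .of_le (n := ∞) (by norm_cast)
  have := ContMDiffOn.inner_bundle (key v) (key w)
  exact contMDiffOn_iff_contDiffOn.1 this

theorem contDiffOn_metricForm (c : M) :
    ContDiffOn ℝ 1 (metricForm c) (extChartAt (𝓡 d) c).target := by
  rw [contDiffOn_clm_apply]
  intro v
  rw [contDiffOn_clm_apply]
  intro w
  exact contDiffOn_metricInChart c v w

-- With all three vectors equal to `u'`, the Christoffel expression collapses to half the derivative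
-- of the metric along `u'`; by symmetry of the metric the two `u''` terms agree.
set_option synthInstance.maxHeartbeats 200000 in
theorem hasDerivAt_metricForm_self {c : M} {u : ℝ → EuclideanSpace ℝ (Fin d)} {t : ℝ}
    (hut : u t ∈ (extChartAt (𝓡 d) c).target) (hu : DifferentiableAt ℝ u t)
    (hu' : DifferentiableAt ℝ (deriv u) t) :
    HasDerivAt (fun s => metricInChart c (u s) (deriv u s) (deriv u s))
      (2 * (metricInChart c (u t) (deriv (deriv u) t) (deriv u t) +
        christoffelFirst c (u t) (deriv u t) (deriv u t) (deriv u t))) t := by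
  have hG : DifferentiableAt ℝ (metricForm c) (u t) :=
    ((contDiffOn_metricForm c).differentiableOn one_ne_zero).differentiableAt
      ((isOpen_extChartAt_target c).mem_nhds hut)
  have h2 := hasDerivAt_bilinear_self hG hu hu'
  have h3 : ∀ a b w : EuclideanSpace ℝ (Fin d), fderiv ℝ (fun y => metricInChart c y b w) (u t) a =
      fderiv ℝ (metricForm c) (u t) a b w := fun a b w => fderiv_bilinear_apply hG a b w
  refine h2.congr_deriv ?_
  simp only [christoffelFirst, h3, metricForm_apply]
  rw [metricInChart_comm c (u t) (deriv u t) (deriv (deriv u) t)]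
  ring

theorem IsGeodesicOn.hasDerivAt_inner {γ : ℝ → M} {J : Set ℝ} (hJ : IsOpen J)
    (h : IsGeodesicOn (d := d) γ J) {t : ℝ} (ht : t ∈ J) :
    HasDerivAt (fun s => inner ℝ
      (mfderiv 𝓘(ℝ, ℝ) (𝓡 d) γ s (1 : ℝ) : TangentSpace (𝓡 d) (γ s))
      (mfderiv 𝓘(ℝ, ℝ) (𝓡 d) γ s (1 : ℝ) : TangentSpace (𝓡 d) (γ s))) 0 t := by
  set c := γ t with hc
  set u : ℝ → EuclideanSpace ℝ (Fin d) := fun s => extChartAt (𝓡 d) c (γ s) with hu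
  have hsrc : ∀ᶠ s in 𝓝 t, s ∈ J ∧ γ s ∈ (extChartAt (𝓡 d) c).source :=
    (show ∀ᶠ s in 𝓝 t, s ∈ J from hJ.mem_nhds ht).and ((h.1.continuousOn.continuousAt (IsOpen.mem_nhds hJ ht)).eventually_mem
      (extChartAt_source_mem_nhds (I := 𝓡 d) c))
  have hus : ∀ s, s ∈ J → γ s ∈ (extChartAt (𝓡 d) c).source → ContDiffAt ℝ ∞ u s := by
    intro s hs hs'
    rw [← contMDiffAt_iff_contDiffAt]
    exact (contMDiffAt_extChartAt' (by simpa using hs')).comp s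
      (h.1.contMDiffAt (hJ.mem_nhds hs))
  have htc : γ t ∈ (extChartAt (𝓡 d) c).source := by rw [← hc]; exact mem_extChartAt_source c
  have hut := hus t ht htc
  have hd := hasDerivAt_metricForm_self (c := c) (u := u) (t := t)
    ((extChartAt (𝓡 d) c).map_source htc)
    (hut.differentiableAt (by simp))
    ((hut.derivWithin (m := 1) (by norm_cast)).differentiableAt (by simp))
  -- The geodesic equation tested against `w = u'` says exactly that this derivative vanishes.
  rw [h.2 t ht c (by simpa using htc) (deriv u t), mul_zero] at hd
  refine hd.congr_of_eventuallyEq ?_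
  filter_upwards [hsrc, hsrc.eventually_nhds] with s hs hs2
  have hγ : γ =ᶠ[𝓝 s] (extChartAt (𝓡 d) c).symm ∘ u := by
    filter_upwards [hs2] with r hr
    exact ((extChartAt (𝓡 d) c).left_inv hr.2).symm
  have hus' := (hus s hs.1 hs.2).differentiableAt (by simp)
  have hmd : MDifferentiableAt 𝓘(ℝ, EuclideanSpace ℝ (Fin d)) (𝓡 d)
      (extChartAt (𝓡 d) c).symm (u s) :=
    ((mdifferentiableOn_extChartAt_symm (I := 𝓡 d) (x := c)).mdifferentiableAt
      ((isOpen_extChartAt_target c).mem_nhds ((extChartAt (𝓡 d) c).map_source hs.2)))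
  have hchain : ∀ v : ℝ, mfderiv 𝓘(ℝ, ℝ) (𝓡 d) ((extChartAt (𝓡 d) c).symm ∘ u) s v =
      mfderiv 𝓘(ℝ, EuclideanSpace ℝ (Fin d)) (𝓡 d) (extChartAt (𝓡 d) c).symm (u s)
        (mfderiv 𝓘(ℝ, ℝ) 𝓘(ℝ, EuclideanSpace ℝ (Fin d)) u s v) :=
    fun v => mfderiv_comp_apply s hmd hus'.mdifferentiableAt v
  have hu1 : mfderiv 𝓘(ℝ, ℝ) 𝓘(ℝ, EuclideanSpace ℝ (Fin d)) u s (1 : ℝ) = deriv u s := by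
    rw [mfderiv_eq_fderiv]
    rfl
  have hvel : (⟨γ s, mfderiv 𝓘(ℝ, ℝ) (𝓡 d) γ s (1 : ℝ)⟩ : TangentBundle (𝓡 d) M) =
      ⟨(extChartAt (𝓡 d) c).symm (u s), mfderiv 𝓘(ℝ, EuclideanSpace ℝ (Fin d)) (𝓡 d)
        (extChartAt (𝓡 d) c).symm (u s) (deriv u s)⟩ := by
    refine TotalSpace.ext hγ.eq_of_nhds (heq_of_eq ?_)
    have h1 := congrArg (fun L : ℝ →L[ℝ] EuclideanSpace ℝ (Fin d) => L 1)
      (hγ.mfderiv_eq (I := 𝓘(ℝ, ℝ)) (I' := 𝓡 d))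
    refine h1.trans ((hchain 1).trans ?_)
    exact congrArg (mfderiv 𝓘(ℝ, EuclideanSpace ℝ (Fin d)) (𝓡 d)
        (extChartAt (𝓡 d) c).symm (u s)) hu1
  exact congrArg (fun P : TangentBundle (𝓡 d) M => (inner ℝ P.2 P.2 : ℝ)) hvel

theorem IsGeodesicOn.norm_eq {γ : ℝ → M} {a b : ℝ} (h : IsGeodesicOn (d := d) γ (Ioo a b))
    {s t : ℝ} (hs : s ∈ Ioo a b) (ht : t ∈ Ioo a b) :
    ‖(mfderiv 𝓘(ℝ, ℝ) (𝓡 d) γ s (1 : ℝ) : TangentSpace (𝓡 d) (γ s))‖ =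
      ‖(mfderiv 𝓘(ℝ, ℝ) (𝓡 d) γ t (1 : ℝ) : TangentSpace (𝓡 d) (γ t))‖ := by
  have hd := fun r (hr : r ∈ Ioo a b) => h.hasDerivAt_inner isOpen_Ioo hr
  have := (convex_Ioo a b).is_const_of_fderivWithin_eq_zero (𝕜 := ℝ)
    (fun r hr => (hd r hr).differentiableAt.differentiableWithinAt)
    (fun r hr => by
      rw [fderivWithin_of_isOpen isOpen_Ioo hr, (hd r hr).hasFDerivAt.fderiv]
      ext
      simp) hs ht
  rw [norm_eq_sqrt_real_inner, norm_eq_sqrt_real_inner]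
  exact congrArg Real.sqrt this

/-! ### Upper distance bound for the exponential map. -/

variable [IsRiemannianManifold (𝓡 d) M]

/-- By constancy of speed, the geodesic on `[0, 1]` has length `‖v‖`, and length dominates distance.
-/
theorem IsExp.dist_le {z y : M} {v : TangentSpace (𝓡 d) z} (h : IsExp z v y) :
    dist z y ≤ ‖v‖ := by
  obtain ⟨γ, δ, hδ, hγ, h0, h1⟩ := h
  have hsub : Icc (0 : ℝ) 1 ⊆ Ioo (-δ) (1 + δ) := fun t ht => ⟨by linarith [ht.1], by linarith [ht.2]⟩
  have h0' : ‖(mfderiv 𝓘(ℝ, ℝ) (𝓡 d) γ 0 (1 : ℝ) : TangentSpace (𝓡 d) (γ 0))‖ = ‖v‖ :=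
    congrArg (fun P : TangentBundle (𝓡 d) M => ‖P.2‖) h0
  have hz : γ 0 = z := congrArg (fun P : TangentBundle (𝓡 d) M => P.1) h0
  have hlen : Manifold.pathELength (𝓡 d) γ 0 1 = ENNReal.ofReal ‖v‖ := by
    rw [Manifold.pathELength_eq_lintegral_mfderiv_Icc]
    have : ∫⁻ t in Icc (0 : ℝ) 1,
        ‖(mfderiv 𝓘(ℝ, ℝ) (𝓡 d) γ t (1 : ℝ) : TangentSpace (𝓡 d) (γ t))‖ₑ =
        ∫⁻ _ in Icc (0 : ℝ) 1, ENNReal.ofReal ‖v‖ := by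
      refine setLIntegral_congr_fun measurableSet_Icc fun t ht => ?_
      have := hγ.norm_eq (hsub ht) (hsub (left_mem_Icc.2 zero_le_one))
      simp only [← ofReal_norm]
      rw [this, h0']
    exact this.trans (by simp)
  have hle : Manifold.riemannianEDist (𝓡 d) z y ≤ Manifold.pathELength (𝓡 d) γ 0 1 :=
    Manifold.riemannianEDist_le_pathELength ((hγ.1.mono hsub).of_le (by norm_cast)) hz h1
      zero_le_one
  rw [← IsRiemannianManifold.out (I := 𝓡 d) z y, hlen, edist_dist] at hle
  exact (ENNReal.ofReal_le_ofReal_iff (norm_nonneg _)).1 hle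

theorem dist_Exp_le (z : M) (v : TangentSpace (𝓡 d) z) : dist z (Exp z v) ≤ ‖v‖ := by
  by_cases h : ∃ y, IsExp z v y
  · exact (isExp_Exp h).dist_le
  · rw [Exp, dif_neg h, dist_self]
    exact norm_nonneg v

end NormingSets
end

/-! ### Covering by local homeomorphisms, and balls inside cones. -/

/-- A local homeomorphism on a ball which is bounded below there with the constant `Γ` covers any
preconnected set through the image of the centre in the ball of radius `Γ * δ`. -/
theorem IsLocalHomeomorphOn.subset_image_ball {E X : Type*} [PseudoMetricSpace E] [ProperSpace E]
    [MetricSpace X] {f : E → X} {w₀ : E} {δ Γ : ℝ} (hΓ : 0 < Γ)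
    (hf : IsLocalHomeomorphOn f (ball w₀ δ))
    (hlow : ∀ v ∈ ball w₀ δ, ∀ w ∈ ball w₀ δ, Γ * dist v w ≤ dist (f v) (f w))
    {S : Set X} (hS : IsPreconnected S) (hSb : S ⊆ ball (f w₀) (Γ * δ)) (h₀ : f w₀ ∈ S) :
    S ⊆ f '' ball w₀ δ := by
  have hδ : 0 < δ := by
    have := pos_of_mem_ball (hSb h₀)
    exact (pos_iff_pos_of_mul_pos this).1 hΓ
  have hw₀ : w₀ ∈ ball w₀ δ := mem_ball_self hδ
  have hopen : IsOpen (f '' ball w₀ δ) := by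
    rw [isOpen_iff_mem_nhds]
    rintro _ ⟨w, hw, rfl⟩
    rw [← hf.map_nhds_eq hw]
    exact image_mem_map (isOpen_ball.mem_nhds hw)
  -- The image is open and meets `S`, so it is enough that it is relatively closed in `S`.
  refine hS.subset_of_closure_inter_subset hopen ⟨f w₀, h₀, w₀, hw₀, rfl⟩ ?_
  rintro q ⟨hq, hqS⟩
  have hqd : dist q (f w₀) / Γ < δ := by
    rw [div_lt_iff₀ hΓ, mul_comm]
    exact hSb hqS
  -- The lower bound puts preimages of points near `q` in the compact `closedBall w₀ δ'`, whose
  -- image is closed.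
  obtain ⟨δ', hδ', hδ'δ⟩ := exists_between hqd
  rw [div_lt_iff₀ hΓ, mul_comm] at hδ'
  have hcl : IsClosed (f '' closedBall w₀ δ') :=
    ((isCompact_closedBall w₀ δ').image_of_continuousOn
      (hf.continuousOn.mono (closedBall_subset_ball hδ'δ))).isClosed
  have hmem : q ∈ closure (f '' ball w₀ δ ∩ ball (f w₀) (Γ * δ')) :=
    isOpen_ball.closure_inter ⟨hq, hδ'⟩
  have hsub : f '' ball w₀ δ ∩ ball (f w₀) (Γ * δ') ⊆ f '' closedBall w₀ δ' := by
    rintro _ ⟨⟨w, hw, rfl⟩, hwd⟩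
    refine ⟨w, ?_, rfl⟩
    have := (hlow w hw w₀ hw₀).trans_lt hwd
    exact (lt_of_mul_lt_mul_left this hΓ.le).le
  exact image_mono (closedBall_subset_ball hδ'δ) (hcl.closure_subset_iff.2 hsub hmem)

/-- Squaring the hypothesis gives `‖w‖² + t² cos² θ ≤ 2t⟨v, w⟩`, and the left side is at least `2t
‖w‖ cos θ`. -/
theorem norm_mul_cos_le_inner {E : Type*} [NormedAddCommGroup E] [InnerProductSpace ℝ E] {v w : E}
    (hv : ‖v‖ = 1) {t θ : ℝ} (ht : 0 < t) (h : ‖w - t • v‖ ≤ t * Real.sin θ) :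
    ‖w‖ * Real.cos θ ≤ inner ℝ v w := by
  have h1 : ‖w - t • v‖ ^ 2 ≤ (t * Real.sin θ) ^ 2 := by gcongr
  rw [norm_sub_sq_real, norm_smul, real_inner_smul_right, hv, Real.norm_of_nonneg ht.le, mul_one,
    real_inner_comm, mul_pow, Real.sin_sq] at h1
  have h2 := sq_nonneg (‖w‖ - t * Real.cos θ)
  refine le_of_mul_le_mul_left (a := 2 * t) ?_ (by positivity)
  nlinarith

/-! ### Sup norms, iterated doubling and gradient estimates. -/

namespace NormingSets

section

variable {M : Type*}

theorem supNorm_mono (p : M → ℝ) {S T : Set M} (h : S ⊆ T) : supNorm p S ≤ supNorm p T :=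
  biSup_mono h

variable [MetricSpace M]

theorem exists_dist_lt_of_fillDistance_lt {Ξ Ω : Set M} {h : ℝ}
    (hh : fillDistance Ξ Ω < ENNReal.ofReal h) {x : M} (hx : x ∈ Ω) : ∃ ξ ∈ Ξ, dist x ξ < h := by
  have h1 : infEDist x Ξ < ENNReal.ofReal h :=
    (le_biSup (fun x => infEDist x Ξ) hx).trans_lt hh
  obtain ⟨ξ, hξ, hd⟩ := infEDist_lt_iff.1 h1
  exact ⟨ξ, hξ, edist_lt_ofReal.1 hd⟩

end

section

variable {d : ℕ} {M : Type*} [MetricSpace M] [ChartedSpace (EuclideanSpace ℝ (Fin d)) M]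
  [RiemannianBundle (fun x : M => TangentSpace (𝓡 d) x)]

theorem DoublingMarkov.supNorm_ball_two_pow_le {P : Submodule ℝ (M → ℝ)} {D K r₀ : ℝ}
    (hP : DoublingMarkov d P D K r₀) {p : M → ℝ} (hp : p ∈ P) {ρ : ℝ} (hρ : 0 < ρ) (y : M) (m : ℕ)
    (hm : ∀ k < m, 2 ^ k * ρ < r₀) :
    supNorm p (ball y (2 ^ m * ρ)) ≤ ENNReal.ofReal ((2 : ℝ) ^ D) ^ m * supNorm p (ball y ρ) := by
  induction m with
  | zero => simp
  | succ m ih =>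
    rw [pow_succ' (2 : ℝ), mul_assoc, pow_succ', mul_assoc]
    refine (hP.doubling p hp _ (by positivity) (hm m (Nat.lt_succ_self m)) y).trans ?_
    gcongr
    exact ih fun k hk => hm k (hk.trans (Nat.lt_succ_self m))

theorem DoublingMarkov.supNorm_ball_two_mul_le {P : Submodule ℝ (M → ℝ)} {D K r₀ : ℝ}
    (hP : DoublingMarkov d P D K r₀) {p : M → ℝ} (hp : p ∈ P) {ρ R : ℝ} (hρ : 0 < ρ) (hρR : ρ ≤ R)
    (hR : R < r₀) (y : M) :
    supNorm p (ball y (2 * R)) ≤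
      ENNReal.ofReal ((2 : ℝ) ^ (2 * D) * (R / ρ) ^ D) * supNorm p (ball y ρ) := by
  have hR0 : 0 < R := hρ.trans_le hρR
  have hex : ∃ m : ℕ, R ≤ 2 ^ m * ρ := by
    obtain ⟨m, hm⟩ := pow_unbounded_of_one_lt (R / ρ) (one_lt_two (α := ℝ))
    exact ⟨m, ((div_lt_iff₀ hρ).1 hm).le⟩
  classical
  set m := Nat.find hex with hm
  have hmR : R ≤ 2 ^ m * ρ := Nat.find_spec hex
  have hlt : ∀ k < m, 2 ^ k * ρ < R := fun k hk => not_le.1 (Nat.find_min hex hk)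
  -- Minimality of `m` makes `2 ^ m` overshoot `R / ρ` by at most a factor `2`. The further doubling
  -- from `R` to `2 * R` makes this `4`, hence the factor `2 ^ (2 * D)`.
  have hpow : (2 : ℝ) ^ m ≤ 2 * (R / ρ) := by
    rw [← mul_div_assoc, le_div_iff₀ hρ]
    rcases Nat.eq_zero_or_pos m with h0 | h0
    · rw [h0]
      linarith
    · obtain ⟨k, hk⟩ := Nat.exists_eq_succ_of_ne_zero h0.ne'
      have := hlt k (hk ▸ Nat.lt_succ_self k)
      rw [hk, pow_succ]
      linarith
  have hD := hP.exponent_pos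
  calc supNorm p (ball y (2 * R))
      ≤ ENNReal.ofReal ((2 : ℝ) ^ D) * supNorm p (ball y R) := hP.doubling p hp R hR0 hR y
    _ ≤ ENNReal.ofReal ((2 : ℝ) ^ D) * supNorm p (ball y (2 ^ m * ρ)) := by
        gcongr
        exact supNorm_mono p (ball_subset_ball hmR)
    _ ≤ ENNReal.ofReal ((2 : ℝ) ^ D) * (ENNReal.ofReal ((2 : ℝ) ^ D) ^ m * supNorm p (ball y ρ)) := by
        gcongr
        exact hP.supNorm_ball_two_pow_le hp hρ y m fun k hk => (hlt k hk).trans hR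
    _ = ENNReal.ofReal (((2 : ℝ) ^ (m + 1)) ^ D) * supNorm p (ball y ρ) := by
        rw [← mul_assoc, ← pow_succ', ← ENNReal.ofReal_pow (by positivity), ← Real.rpow_mul_natCast
          (by norm_num), mul_comm D, Real.rpow_mul (by norm_num), Real.rpow_natCast]
    _ ≤ _ := by
        gcongr
        rw [Real.rpow_mul (by norm_num), ← Real.mul_rpow (by positivity) (by positivity)]
        refine Real.rpow_le_rpow (by positivity) ?_ hD.le
        rw [pow_succ, Real.rpow_two]
        linarith

/-- Integrate the derivative of `p ∘ γ`, bounded by the dual norm of the gradient times the speed.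
-/
theorem enorm_sub_le_mul_pathELength {p : M → ℝ} (hp : ContMDiff (𝓡 d) 𝓘(ℝ, ℝ) 1 p) {γ : ℝ → M}
    (hγ : ContMDiffOn 𝓘(ℝ, ℝ) (𝓡 d) 1 γ (Icc 0 1)) {S : Set M} (hS : ∀ t ∈ Icc (0 : ℝ) 1, γ t ∈ S)
    (htop : supNormGrad d p S ≠ ⊤) :
    ‖p (γ 1) - p (γ 0)‖ₑ ≤ supNormGrad d p S * Manifold.pathELength (𝓡 d) γ 0 1 := by
  have hc : ContDiffOn ℝ 1 (p ∘ γ) (Icc 0 1) :=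
    contMDiffOn_iff_contDiffOn.1 (hp.comp_contMDiffOn hγ)
  refine (enorm_sub_le_lintegral_deriv_of_contDiffOn_Icc hc zero_le_one).trans ?_
  rw [Manifold.pathELength_eq_lintegral_mfderiv_Ioo, ← restrict_Ioo_eq_restrict_Icc,
    ← lintegral_const_mul' _ _ htop]
  refine setLIntegral_mono' measurableSet_Ioo fun t ht => ?_
  have hγt : MDifferentiableAt 𝓘(ℝ, ℝ) (𝓡 d) γ t :=
    ((hγ t (Ioo_subset_Icc_self ht)).contMDiffAt (Icc_mem_nhds ht.1 ht.2)).mdifferentiableAt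
      one_ne_zero
  have hpt : MDifferentiableAt (𝓡 d) 𝓘(ℝ, ℝ) p (γ t) := hp.mdifferentiableAt one_ne_zero
  have hd : deriv (p ∘ γ) t = grad d p (γ t) (mfderiv 𝓘(ℝ, ℝ) (𝓡 d) γ t (1 : ℝ)) := by
    have := mfderiv_comp_apply t hpt hγt (1 : ℝ)
    rw [mfderiv_eq_fderiv] at this
    exact this
  rw [hd]
  refine ((grad d p (γ t)).le_opENorm _).trans ?_
  exact mul_le_mul' (le_biSup (fun x => ‖grad d p x‖ₑ) (hS t (Ioo_subset_Icc_self ht))) le_rfl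

theorem DoublingMarkov.supNormGrad_le {P : Submodule ℝ (M → ℝ)} {D K r₀ : ℝ}
    (hP : DoublingMarkov d P D K r₀) {p : M → ℝ} (hp : p ∈ P) {y z : M} {ρ R σ : ℝ} (hρ : 0 < ρ)
    (hρR : ρ ≤ R) (hR : R < r₀) (hσ : 0 < σ) (hσR : σ ≤ R) (hz : dist z y + σ ≤ 2 * R) :
    supNormGrad d p (ball z σ) ≤
      ENNReal.ofReal (K / σ * ((2 : ℝ) ^ (2 * D) * (R / ρ) ^ D)) * supNorm p (ball y ρ) := by
  rw [ENNReal.ofReal_mul (div_pos hP.const_pos hσ).le, mul_assoc]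
  refine (hP.markov p hp σ hσ (hσR.trans_lt hR) z).trans ?_
  gcongr
  exact (supNorm_mono p (ball_subset_ball' (by linarith))).trans
    (hP.supNorm_ball_two_mul_le hp hρ hρR hR y)

variable [IsRiemannianManifold (𝓡 d) M]

theorem enorm_sub_le_supNormGrad_mul {p : M → ℝ} (hp : ContMDiff (𝓡 d) 𝓘(ℝ, ℝ) 1 p) {x y : M}
    {r : ℝ} (h : dist x y < r) :
    ‖p y - p x‖ₑ ≤ supNormGrad d p (ball x r) * ENNReal.ofReal r := by
  obtain ⟨γ, h0, h1, hγ, hl, hb⟩ := exists_path_of_dist_lt (d := d) h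
  by_cases htop : supNormGrad d p (ball x r) = ⊤
  · rw [htop, ENNReal.top_mul (ENNReal.ofReal_pos.2 (dist_nonneg.trans_lt h)).ne']
    exact le_top
  have := enorm_sub_le_mul_pathELength hp hγ hb htop
  rw [h0, h1] at this
  exact this.trans (by gcongr)

theorem IsExpRadius.ball_subset_image {Ω : Set M} {r Γ : ℝ} (h : IsExpRadius d Ω r Γ) {z : M}
    (hz : z ∈ Ω) {w₀ : TangentSpace (𝓡 d) z} {δ : ℝ} (hw : ball w₀ δ ⊆ ball 0 r) :
    ball (Exp z w₀) (Γ * δ) ⊆ Exp z '' ball w₀ δ := by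
  intro q hq
  obtain ⟨γ, h0, h1, hγ, -, hb⟩ := exists_path_of_dist_lt (d := d) (mem_ball'.1 hq)
  have : FiniteDimensional ℝ (TangentSpace (𝓡 d) z) :=
    inferInstanceAs (FiniteDimensional ℝ (EuclideanSpace ℝ (Fin d)))
  have : ProperSpace (TangentSpace (𝓡 d) z) := FiniteDimensional.proper_real _
  have hloc : IsLocalHomeomorphOn (Exp z) (ball w₀ δ) :=
    (h.localDiffeo z hz).isLocalHomeomorphOn.mono hw
  -- The connected set to be covered is a path from the centre to `q` that stays in the ball.
  have hsub := hloc.subset_image_ball h.const_pos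
    (fun v hv w hw' => by
      rw [dist_eq_norm]
      exact h.lower z hz v (hw hv) w (hw hw'))
    (isPreconnected_Icc.image γ hγ.continuousOn) (image_subset_iff.2 hb)
    ⟨0, left_mem_Icc.2 zero_le_one, h0⟩
  exact hsub ⟨1, right_mem_Icc.2 zero_le_one, h1⟩

end

end NormingSets

/-! ### A ball inside the domain, and the main estimate. -/

section

variable {d : ℕ} {M : Type*} [MetricSpace M] [ChartedSpace (EuclideanSpace ℝ (Fin d)) M]
  [IsManifold (𝓡 d) ∞ M] [RiemannianBundle (fun x : M => TangentSpace (𝓡 d) x)]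
  [IsContMDiffRiemannianBundle (𝓡 d) ∞ (EuclideanSpace ℝ (Fin d))
    (fun x : M => TangentSpace (𝓡 d) x)]
  [IsRiemannianManifold (𝓡 d) M]

namespace NormingSets

/-- Along a nonzero vector from the centre, the lower bound `Γ ‖v‖` meets the upper bound `‖v‖`. -/
theorem IsExpRadius.const_le_one {Ω : Set M} {r Γ : ℝ} (h : IsExpRadius d Ω r Γ) {z : M}
    (hz : z ∈ Ω) {v : TangentSpace (𝓡 d) z} (hv : v ∈ ball 0 r) (hv0 : 0 < ‖v‖) : Γ ≤ 1 := by
  have h0 : Exp z (0 : TangentSpace (𝓡 d) z) = z := by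
    have := dist_Exp_le z (0 : TangentSpace (𝓡 d) z)
    rw [norm_zero] at this
    exact (dist_le_zero.1 this).symm
  have h1 := h.lower z hz v hv 0 (mem_ball_self h.radius_pos)
  rw [sub_zero, h0, dist_comm] at h1
  exact le_of_mul_le_mul_right ((h1.trans (dist_Exp_le z v)).trans_eq (one_mul _).symm) hv0

/-- Under the cone condition, `closedBall x R ∩ Ω` contains a ball of radius comparable to `R`. -/
theorem exists_ball_subset {Ω : Set M} {r Γ : ℝ} (h : IsExpRadius d Ω r Γ) {r' θ : ℝ}
    (hθ₀ : 0 < θ) (hθ : θ < Real.pi / 2) (hcone : GeodesicConeCondition d Ω r' θ) {R : ℝ}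
    (hR₀ : 0 < R) (hR : R < r) (hR' : R ≤ r') {x : M} (hx : x ∈ Ω) :
    Γ ≤ 1 ∧ ∃ y : M, dist x y ≤ R / (1 + Real.sin θ) ∧
      ball y (Γ * (R / (1 + Real.sin θ) * Real.sin θ)) ⊆ closedBall x R ∩ Ω := by
  have hs : 0 < Real.sin θ := Real.sin_pos_of_pos_of_lt_pi hθ₀ (by linarith [Real.pi_pos])
  obtain ⟨v, hv, hvc⟩ := hcone x hx
  -- For this `t`, the ball of radius `t sin θ` about `t • v` lies in the cone and, as `t + t sin θ
  -- = R`, in the ball of radius `R` about `0`.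
  set t := R / (1 + Real.sin θ) with ht
  have ht0 : 0 < t := by positivity
  have hts : t + t * Real.sin θ = R := by
    rw [ht]
    field_simp
  have hnorm : ‖t • v‖ = t := by rw [norm_smul, hv, Real.norm_of_nonneg ht0.le, mul_one]
  have hballR : ∀ w ∈ ball (t • v) (t * Real.sin θ), ‖w‖ < R := by
    intro w hw
    rw [mem_ball_iff_norm] at hw
    have := norm_le_norm_add_norm_sub' w (t • v)
    linarith
  have htr : t • v ∈ ball (0 : TangentSpace (𝓡 d) x) r := by
    rw [mem_ball_zero_iff, hnorm]
    nlinarith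
  refine ⟨h.const_le_one hx htr (by rw [hnorm]; exact ht0), Exp x (t • v),
    (dist_Exp_le x _).trans_eq hnorm, fun q hq => ?_⟩
  obtain ⟨w, hw, rfl⟩ := h.ball_subset_image hx
    (fun w hw => mem_ball_zero_iff.2 ((hballR w hw).trans hR)) hq
  have hwR := hballR w hw
  refine ⟨mem_closedBall'.2 ((dist_Exp_le x w).trans hwR.le), (hvc w ⟨hwR.le.trans hR', ?_⟩).2⟩
  exact norm_mul_cos_le_inner hv ht0 (mem_ball_iff_norm.1 hw).le

end NormingSets

end

theorem corollary3p4 {d : ℕ} {M : Type*} [MetricSpace M]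
    [ChartedSpace (EuclideanSpace ℝ (Fin d)) M] [IsManifold (𝓡 d) ∞ M]
    [RiemannianBundle (fun x : M => TangentSpace (𝓡 d) x)]
    [IsContMDiffRiemannianBundle (𝓡 d) ∞ (EuclideanSpace ℝ (Fin d))
      (fun x : M => TangentSpace (𝓡 d) x)]
    [IsRiemannianManifold (𝓡 d) M] [ConnectedSpace M]
    -- the function space, with its doubling and Markov constants
    (P : Submodule ℝ (M → ℝ)) (D K rSharp : ℝ) (hP : DoublingMarkov d P D K rSharp)
    -- the domain, its exponential radius and its cone condition
    (Ω : Set M) (hΩ : IsCompact Ω)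
    (rΩ Γ₁ : ℝ) (hexp : IsExpRadius d Ω rΩ Γ₁)
    (rFlat θ : ℝ) (hrFlat : 0 < rFlat) (hθ₀ : 0 < θ) (hθ : θ < Real.pi / 2)
    (hcone : GeodesicConeCondition d Ω rFlat θ)
    -- `K` is not so small that the constants degenerate (automatic if `1 ≤ K`)
    (hκ : (1 + Γ₁ * Real.sin θ) / (Γ₁ * Real.sin θ) < kappa K D Γ₁ θ)
    (ε R : ℝ) (hε : 0 < ε) (hR₀ : 0 < R)
    (hR : R ≤ min rΩ (min rSharp rFlat) / (1 + ε))
    (Ξ : Set M) (hΞ : Ξ ⊆ Ω)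
    (hh : fillDistance Ξ Ω ≤ ENNReal.ofReal (ε * (R / kappa K D Γ₁ θ)))
    (x : M) (hx : x ∈ Ω) :
    (∀ p ∈ P, ∃ ξ ∈ Ξ ∩ ball x ((1 + ε) * R),
      ENNReal.ofReal (1 - ε) * supNorm p (closedBall x R ∩ Ω) ≤ ‖p ξ‖ₑ) ∧
    (ε < 1 → IsNormingSet P (closedBall x R ∩ Ω) (Ξ ∩ ball x ((1 + ε) * R))) := by
  have main : ∀ p ∈ P, ∃ ξ ∈ Ξ ∩ ball x ((1 + ε) * R),
      ENNReal.ofReal (1 - ε) * supNorm p (closedBall x R ∩ Ω) ≤ ‖p ξ‖ₑ := by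
    intro p hp
    have hs : 0 < Real.sin θ := Real.sin_pos_of_pos_of_lt_pi hθ₀ (by linarith [Real.pi_pos])
    have hΓ := hexp.const_pos
    have hK := hP.const_pos
    have hD := hP.exponent_pos
    have hRmin : R < min rΩ (min rSharp rFlat) := by
      rw [le_div_iff₀ (by linarith)] at hR
      nlinarith
    rw [lt_min_iff, lt_min_iff] at hRmin
    obtain ⟨hRΩ, hRS, hRF⟩ := hRmin
    obtain ⟨hΓ1, y, hxy, hball⟩ :=
      NormingSets.exists_ball_subset hexp hθ₀ hθ hcone hR₀ hRΩ hRF.le hx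
    obtain ⟨z, ⟨hzx, hzΩ⟩, hz⟩ := (hΩ.inter_left isClosed_closedBall).exists_isMaxOn
      ⟨x, mem_closedBall_self hR₀.le, hx⟩ (hP.contMDiff p hp).continuous.abs.continuousOn
    have hsup : supNorm p (closedBall x R ∩ Ω) ≤ ‖p z‖ₑ :=
      iSup₂_le fun q hq => by
        rw [← ofReal_norm, ← ofReal_norm]
        exact ENNReal.ofReal_le_ofReal (hz hq)
    set s := Real.sin θ with hsdef
    set q := (1 + Γ₁ * s) / (Γ₁ * s) with hq
    set C := K * ((2 : ℝ) ^ (2 * D) * ((1 + s) / (Γ₁ * s)) ^ D) * q with hC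
    have hΓs : 0 < Γ₁ * s := mul_pos hΓ hs
    have hq1 : 1 < q := by
      rw [hq, one_lt_div hΓs]
      linarith
    have hCκ : C < kappa K D Γ₁ θ := by
      rw [hC, kappa, ← hsdef, ← hq, ← mul_assoc K]
      have : ((1 + s) / (Γ₁ * s)) ^ D < ((2 + s) / (Γ₁ * s)) ^ D := by
        apply Real.rpow_lt_rpow (by positivity) _ hD
        gcongr
        norm_num
      gcongr
    -- The distance to `Ξ` need not be attained, so room below `κ` is needed. It comes from `hκ` and
    -- from the `2 + s` in `κ`, where the estimate only uses `1 + s`.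
    obtain ⟨κ', hκ', hκκ⟩ := exists_between (max_lt hκ hCκ)
    obtain ⟨hqκ, hCκ'⟩ := max_lt_iff.1 hκ'
    have hκ'0 : 0 < κ' := by linarith
    have hκ0 : 0 < kappa K D Γ₁ θ := by linarith
    obtain ⟨ξ, hξ, hd⟩ := NormingSets.exists_dist_lt_of_fillDistance_lt (h := ε * (R / κ'))
      (hh.trans_lt ((ENNReal.ofReal_lt_ofReal_iff (by positivity)).2 (by gcongr))) hzΩ
    refine ⟨ξ, ⟨hξ, ?_⟩, ?_⟩
    · have h1 : R / κ' < R := div_lt_self hR₀ (by linarith)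
      have h2 := dist_triangle_right ξ x z
      rw [mem_closedBall, dist_comm] at hzx
      rw [mem_ball]
      rw [dist_comm] at hd
      nlinarith
    rcases le_or_gt 1 ε with hε1 | hε1
    · rw [ENNReal.ofReal_of_nonpos (by linarith), zero_mul]
      exact zero_le
    have hqinv : R / q = R * (Γ₁ * s) / (1 + Γ₁ * s) := by
      rw [hq]
      field_simp
    -- Here `ε < 1` and `q < κ'`, so a gradient bound at the fixed radius `R / q` suffices, with no
    -- `1 / ε` in the Markov factor.
    have hball2 : ball z (ε * (R / κ')) ⊆ ball z (R / q) := by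
      refine ball_subset_ball ?_
      have : R / κ' ≤ R / q := by gcongr
      have : 0 < R / κ' := by positivity
      nlinarith
    have hρ : supNorm p (ball y (Γ₁ * (R / (1 + s) * s))) ≤ ‖p z‖ₑ :=
      (NormingSets.supNorm_mono p hball).trans hsup
    have hts : R / (1 + s) + R / (1 + s) * s = R := by field_simp
    have ht0 : 0 < R / (1 + s) := by positivity
    have hρR : Γ₁ * (R / (1 + s) * s) ≤ R := by
      have : 0 < R / (1 + s) * s := by positivity
      nlinarith
    have hRρ : R / (Γ₁ * (R / (1 + s) * s)) = (1 + s) / (Γ₁ * s) := by field_simp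
    -- This reduces to `Γ₁ ≤ 1`. It puts `ball z (R / q)` inside `ball y (2 * R)`, since `dist z y ≤
    -- R + R / (1 + s)`.
    have hσ : R / q ≤ R / (1 + s) * s := by
      rw [hqinv, div_mul_eq_mul_div, div_le_div_iff₀ (by positivity) (by positivity)]
      have : 0 < R * s := by positivity
      nlinarith
    have hgrad := hP.supNormGrad_le hp (y := y) (z := z) (ρ := Γ₁ * (R / (1 + s) * s)) (R := R)
      (σ := R / q) (by positivity) hρR hRS (by positivity) (by linarith) (by
        have := dist_triangle z x y
        rw [mem_closedBall] at hzx
        linarith)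
    rw [hRρ] at hgrad
    have hdiff : ‖p ξ - p z‖ₑ ≤ ENNReal.ofReal ε * ‖p z‖ₑ := by
      refine (NormingSets.enorm_sub_le_supNormGrad_mul (hP.contMDiff p hp) hd).trans ?_
      have hgr2 : supNormGrad d p (ball z (ε * (R / κ'))) ≤
          ENNReal.ofReal (K / (R / q) * ((2 : ℝ) ^ (2 * D) * ((1 + s) / (Γ₁ * s)) ^ D)) * ‖p z‖ₑ :=
        (biSup_mono hball2).trans (hgrad.trans (by gcongr))
      calc _ ≤ ENNReal.ofReal (K / (R / q) * ((2 : ℝ) ^ (2 * D) * ((1 + s) / (Γ₁ * s)) ^ D)) *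
              ‖p z‖ₑ * ENNReal.ofReal (ε * (R / κ')) := by gcongr
        _ = ENNReal.ofReal (ε * (C / κ')) * ‖p z‖ₑ := by
          rw [mul_right_comm, ← ENNReal.ofReal_mul (by positivity)]
          congr 2
          rw [hC]
          field_simp
        _ ≤ _ := by
          gcongr
          exact mul_le_of_le_one_right hε.le ((div_le_one hκ'0).2 hCκ'.le)
    have hdiff' : |p ξ - p z| ≤ ε * |p z| := by
      rw [← ofReal_norm, ← ofReal_norm, ← ENNReal.ofReal_mul hε.le] at hdiff
      exact (ENNReal.ofReal_le_ofReal_iff (by positivity)).1 hdiff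
    calc ENNReal.ofReal (1 - ε) * supNorm p (closedBall x R ∩ Ω)
        ≤ ENNReal.ofReal (1 - ε) * ‖p z‖ₑ := by gcongr
      _ ≤ ‖p ξ‖ₑ := by
        rw [← ofReal_norm, ← ofReal_norm, ← ENNReal.ofReal_mul (by linarith)]
        refine ENNReal.ofReal_le_ofReal ?_
        rw [Real.norm_eq_abs, Real.norm_eq_abs]
        have := abs_sub_abs_le_abs_sub (p z) (p ξ)
        rw [abs_sub_comm] at this
        linarith
  refine ⟨main, fun hε1 => ⟨1 - ε, by linarith, fun p hp => ?_⟩⟩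
  obtain ⟨ξ, hξ, h⟩ := main p hp
  exact h.trans (le_biSup (fun x => ‖p x‖ₑ) hξ)
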